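/- Let $n\ge 2$. Write the coordinates on $\mathbf{R}^{2n}$ as $(a^1,\dots,a^n,b_1,\dots,b_n)$, let $O(n,n|\mathbf{R})$ be the group of linear transformations of $\mathbf{R}^{2n}$ preserving the quadratic form $\sum_{i=1}^n a^i b_i$, and let $SO(n,n|\mathbf{Z})$ be its subgroup of matrices with integer entries and determinant $+1$. For $R\in GL(n,\mathbf{Z})$ let $\rho(R)$ be the transformation $\tilde a=Ra$, $\tilde b=(R^{-1})^{t}b$. For an antisymmetric $n\times n$ matrix $N$ with integer entries let $\nu(N)$ be the transformation $\tilde a=a+Nb$, $\tilde b=b$. Let $\sigma_2$ be the transformation that interchanges $a^i$ and $b_i$ for $i=1,2$ and fixes all the other coordinates. Then the elements $\rho(R)$ for all $R\in GL(n,\mathbf{Z})$, $\nu(N)$ for all integer antisymmetric $N$, and the single element $\sigma_2$ all belong to $SO(n,n|\mathbf{Z})$, and together they generate the group $SO(n,n|\mathbf{Z})$. -/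

import Mathlib

open Matrix

namespace SplitOrthogonal

/-- The quadratic form `a¹b₁ + ⋯ + aⁿbₙ` on `R²ⁿ`; the coordinates of a vector `x` are
`aⁱ = x (inl i)` and `bᵢ = x (inr i)`. -/
def quadForm (n : ℕ) (R : Type*) [CommRing R] (x : Fin n ⊕ Fin n → R) : R :=
  ∑ i, x (Sum.inl i) * x (Sum.inr i)

/-- `O(n,n|R)`: the invertible linear transformations of `R²ⁿ` preserving the quadratic form. -/
def O (n : ℕ) (R : Type*) [CommRing R] : Subgroup (GL (Fin n ⊕ Fin n) R) where
  carrier := {g | ∀ x, quadForm n R (g.val *ᵥ x) = quadForm n R x}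
  one_mem' := by
    intro x
    simp
  mul_mem' := by
    intro g h hg hh x
    rw [Units.val_mul, ← Matrix.mulVec_mulVec, hg, hh]
  inv_mem' := by
    intro g hg x
    rw [← hg, Matrix.mulVec_mulVec, ← Units.val_mul, mul_inv_cancel, Units.val_one,
      Matrix.one_mulVec]

/-- `SO(n,n|ℤ)`: the integer matrices of determinant `+1` which, regarded as real matrices,
belong to `O(n,n|ℝ)`. -/
def SOInt (n : ℕ) : Subgroup (GL (Fin n ⊕ Fin n) ℤ) :=
  (O n ℝ).comap (Matrix.GeneralLinearGroup.map (Int.castRingHom ℝ)) ⊓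
    (Matrix.GeneralLinearGroup.det (n := Fin n ⊕ Fin n) (R := ℤ)).ker

/-- `ρ(R)`: `ã = R a`, `b̃ = (R⁻¹)ᵗ b`. -/
def rho {n : ℕ} (R : GL (Fin n) ℤ) : GL (Fin n ⊕ Fin n) ℤ where
  val := fromBlocks R.val 0 0 (R⁻¹).valᵀ
  inv := fromBlocks (R⁻¹).val 0 0 R.valᵀ
  val_inv := by
    rw [fromBlocks_multiply, ← transpose_mul, ← Units.val_mul, mul_inv_cancel]
    simp
  inv_val := by
    rw [fromBlocks_multiply, ← transpose_mul, ← Units.val_mul, inv_mul_cancel]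
    simp

/-- `ν(N)`: `ã = a + N b`, `b̃ = b`. -/
def nu {n : ℕ} (N : Matrix (Fin n) (Fin n) ℤ) : GL (Fin n ⊕ Fin n) ℤ where
  val := fromBlocks 1 N 0 1
  inv := fromBlocks 1 (-N) 0 1
  val_inv := by simp [fromBlocks_multiply]
  inv_val := by simp [fromBlocks_multiply]

/-- The diagonal `0`-`1` matrix which keeps the first `k` coordinates and kills the others. -/
def headProj (n k : ℕ) : Matrix (Fin n) (Fin n) ℤ :=
  diagonal fun i => if i.val < k then 1 else 0

/-- `σₖ`: interchanges `aⁱ` and `bᵢ` for each of the first `k` indices `i`, and fixes the other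
coordinates. -/
def sigma (n k : ℕ) : GL (Fin n ⊕ Fin n) ℤ where
  val := fromBlocks (1 - headProj n k) (headProj n k) (headProj n k) (1 - headProj n k)
  inv := fromBlocks (1 - headProj n k) (headProj n k) (headProj n k) (1 - headProj n k)
  val_inv := by
    have h : headProj n k * headProj n k = headProj n k := by simp [headProj]
    simp [fromBlocks_multiply, sub_mul, mul_sub, h]
  inv_val := by
    have h : headProj n k * headProj n k = headProj n k := by simp [headProj]
    simp [fromBlocks_multiply, sub_mul, mul_sub, h]

end SplitOrthogonal

namespace SplitOrthogonal

/-! The proof is a Euclidean algorithm. Write the bar for the exchange of `aⁱ` and `bᵢ`. The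
generated group contains every root transformation on two coordinates of distinct indices
(`exists_root`), and these act on a vector like elementary row operations.

Let `g` be an integral isometry and `v` the image of a coordinate vector. Among all translates of
`v`, take a nonzero coordinate of least absolute value. Division with remainder shows that it
divides every coordinate of another index, so these can be cleared. Isotropy then kills the dual
coordinate, and invertibility makes the surviving one `±1` (`exists_mulVec_single`). Root moves
carry the result to the original coordinate vector, and the dual vector is straightened in the same
way (`exists_mul_mem_fixing_insert`).

Induction removes the hyperbolic planes one at a time. Roots need two free indices, so one plane
remains. Its isometry group has four elements, and the determinant leaves only `±1`, which come from
`ρ` (`mem_gen_of_fixing_compl_singleton`). -/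

/-- The index `i` underlying the coordinate `aⁱ` or `bᵢ`. -/
def idx {n : ℕ} : Fin n ⊕ Fin n → Fin n := Sum.elim id id

@[simp] lemma idx_inl {n : ℕ} (i : Fin n) : idx (Sum.inl i) = i := rfl
@[simp] lemma idx_inr {n : ℕ} (i : Fin n) : idx (Sum.inr i) = i := rfl
@[simp] lemma idx_swap {n : ℕ} (α : Fin n ⊕ Fin n) : idx α.swap = idx α := by
  cases α <;> rfl

lemma ne_of_idx_ne {n : ℕ} {α β : Fin n ⊕ Fin n} (h : idx α ≠ idx β) : α ≠ β :=
  fun e => h (congrArg idx e)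

lemma eq_or_eq_swap {n : ℕ} {α β : Fin n ⊕ Fin n} (h : idx α = idx β) :
    α = β ∨ α = β.swap := by
  rcases α with i | i <;> rcases β with j | j <;> simp_all

lemma swap_ne_self {n : ℕ} (α : Fin n ⊕ Fin n) : α.swap ≠ α := by
  cases α <;> simp

/-- The subgroup generated by the `ρ(R)`, the `ν(N)` and `σ₂`. -/
abbrev gen (n : ℕ) : Subgroup (GL (Fin n ⊕ Fin n) ℤ) :=
  Subgroup.closure
    (Set.range (rho (n := n)) ∪ nu '' {N : Matrix (Fin n) (Fin n) ℤ | N.transpose = -N} ∪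
      {sigma n 2})

lemma rho_mem_gen {n : ℕ} (R : GL (Fin n) ℤ) : rho R ∈ gen n :=
  Subgroup.subset_closure (Or.inl (Or.inl ⟨R, rfl⟩))

lemma nu_mem_gen {n : ℕ} {N : Matrix (Fin n) (Fin n) ℤ} (hN : N.transpose = -N) :
    nu N ∈ gen n :=
  Subgroup.subset_closure (Or.inl (Or.inr ⟨N, hN, rfl⟩))

lemma sigma_mem_gen (n : ℕ) : sigma n 2 ∈ gen n :=
  Subgroup.subset_closure (Or.inr rfl)

/-! ### The generators preserve the form and have determinant one -/

lemma quadForm_eq_dotProduct (n : ℕ) (R : Type*) [CommRing R] (x : Fin n ⊕ Fin n → R) :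
    quadForm n R x = (x ∘ Sum.inl) ⬝ᵥ (x ∘ Sum.inr) := rfl

lemma quadForm_sumElim {n : ℕ} {R : Type*} [CommRing R] (a b : Fin n → R) :
    quadForm n R (Sum.elim a b) = a ⬝ᵥ b := rfl

lemma rho_mem_SOInt {n : ℕ} (R : GL (Fin n) ℤ) : rho R ∈ SOInt n := by
  refine ⟨fun x => ?_, ?_⟩
  · have h : (R⁻¹.val.map (Int.castRingHom ℝ)) * (R.val.map (Int.castRingHom ℝ)) = 1 := by
      rw [← Matrix.map_mul, ← Units.val_mul, inv_mul_cancel]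
      simp
    change quadForm n ℝ (((rho R).val.map (Int.castRingHom ℝ)) *ᵥ x) = _
    simp only [rho, fromBlocks_map, fromBlocks_mulVec, quadForm_sumElim]
    simp only [Matrix.map_zero _ (map_zero _), zero_mulVec, add_zero, zero_add]
    rw [transpose_map, mulVec_transpose, dotProduct_comm, ← dotProduct_mulVec, mulVec_mulVec, h, one_mulVec, dotProduct_comm]
    rfl
  · change GeneralLinearGroup.det (rho R) = 1
    ext
    change (fromBlocks R.val 0 0 (R⁻¹).valᵀ).det = 1
    rw [det_fromBlocks_zero₂₁, det_transpose, ← det_mul, ← Units.val_mul, mul_inv_cancel]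
    simp

lemma nu_mem_SOInt {n : ℕ} {N : Matrix (Fin n) (Fin n) ℤ} (hN : N.transpose = -N) :
    nu N ∈ SOInt n := by
  refine ⟨fun x => ?_, ?_⟩
  · have h : (N.map (Int.castRingHom ℝ))ᵀ = -N.map (Int.castRingHom ℝ) := by
      rw [← transpose_map, hN]
      ext; simp
    change quadForm n ℝ (((nu N).val.map (Int.castRingHom ℝ)) *ᵥ x) = _
    simp only [nu, fromBlocks_map, fromBlocks_mulVec, quadForm_sumElim]
    simp only [Matrix.map_zero _ (map_zero _), zero_mulVec, zero_add,
      Matrix.map_one _ (map_zero _) (map_one _), one_mulVec, add_dotProduct]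
    have h2 : (N.map (Int.castRingHom ℝ)) *ᵥ (x ∘ Sum.inr) ⬝ᵥ (x ∘ Sum.inr) = 0 := by
      have h3 : (N.map (Int.castRingHom ℝ)) *ᵥ (x ∘ Sum.inr) ⬝ᵥ (x ∘ Sum.inr) =
          -((N.map (Int.castRingHom ℝ)) *ᵥ (x ∘ Sum.inr) ⬝ᵥ (x ∘ Sum.inr)) := by
        conv_lhs => rw [dotProduct_comm, dotProduct_mulVec, ← mulVec_transpose, h, neg_mulVec,
          neg_dotProduct]
      linarith
    rw [h2, add_zero, quadForm_eq_dotProduct]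
  · change GeneralLinearGroup.det (nu N) = 1
    ext
    change (fromBlocks 1 N 0 1).det = 1
    simp

lemma sigma_mulVec {n : ℕ} {R : Type*} [CommRing R] (k : ℕ) (x : Fin n ⊕ Fin n → R)
    (γ : Fin n ⊕ Fin n) :
    (((sigma n k).val.map (Int.castRingHom R)) *ᵥ x) γ =
      if (idx γ).val < k then x γ.swap else x γ := by
  have h1 : (headProj n k).map (Int.castRingHom R) =
      diagonal fun i : Fin n => if i.val < k then (1 : R) else 0 := by
    ext i j
    by_cases hij : i = j
    · subst hij; by_cases hi : i.val < k <;> simp [headProj, hi]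
    · simp [headProj, hij]
  have h2 : (1 - headProj n k).map (Int.castRingHom R) =
      diagonal fun i : Fin n => if i.val < k then (0 : R) else 1 := by
    ext i j
    by_cases hij : i = j
    · subst hij; by_cases hi : i.val < k <;> simp [headProj, hi]
    · simp [headProj, hij]
  simp only [sigma, fromBlocks_map, fromBlocks_mulVec, h1, h2]
  rcases γ with i | i <;> by_cases hi : i.val < k <;> simp [mulVec_diagonal, hi]

lemma det_sigma_two {n : ℕ} (hn : 2 ≤ n) : (sigma n 2).val.det = 1 := by
  -- Adding the `b` rows to the `a` rows makes both upper blocks the identity. The Schur complement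
  -- is then `1 - 2 * headProj n 2`, with exactly two entries `-1`.
  have h : (fromBlocks (1 : Matrix (Fin n) (Fin n) ℤ) 1 0 1) * (sigma n 2).val =
      fromBlocks 1 1 (headProj n 2) (1 - headProj n 2) := by
    simp [sigma, fromBlocks_multiply]
  have h2 := congrArg det h
  rw [det_mul, det_fromBlocks_zero₂₁, det_one, one_mul, one_mul, det_fromBlocks_one₁₁,
    mul_one] at h2
  rw [h2]
  have h3 : (1 - headProj n 2 - headProj n 2 : Matrix (Fin n) (Fin n) ℤ) =
      diagonal fun i => if i.val < 2 then -1 else 1 := by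
    ext i j
    by_cases hij : i = j
    · subst hij; by_cases hi : i.val < 2 <;> simp [headProj, hi, -Order.lt_two_iff]
    · simp [headProj, hij]
  rw [h3, det_diagonal]
  obtain ⟨m, rfl⟩ := Nat.exists_eq_add_of_le' hn
  simp [Fin.prod_univ_succ]

lemma sigma_mem_SOInt {n : ℕ} (hn : 2 ≤ n) : sigma n 2 ∈ SOInt n := by
  refine ⟨fun x => ?_, ?_⟩
  · change quadForm n ℝ (((sigma n 2).val.map (Int.castRingHom ℝ)) *ᵥ x) = _
    refine Finset.sum_congr rfl fun i _ => ?_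
    rw [sigma_mulVec, sigma_mulVec]
    by_cases hi : i.val < 2 <;> simp [hi, mul_comm]
  · change GeneralLinearGroup.det (sigma n 2) = 1
    ext
    exact det_sigma_two hn

lemma gen_le_SOInt {n : ℕ} (hn : 2 ≤ n) : gen n ≤ SOInt n := by
  rw [Subgroup.closure_le]
  rintro g ((⟨R, rfl⟩ | ⟨N, hN, rfl⟩) | rfl)
  · exact rho_mem_SOInt R
  · exact nu_mem_SOInt hN
  · exact sigma_mem_SOInt hn

/-! ### Root transformations -/

/-- `h` is the transformation `x ↦ x + t x_β e_α - t x_ᾱ e_β̄`, where the bar exchanges `aⁱ`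
and `bᵢ`. -/
def IsRoot {n : ℕ} (h : GL (Fin n ⊕ Fin n) ℤ) (α β : Fin n ⊕ Fin n) (t : ℤ) : Prop :=
  ∀ x : Fin n ⊕ Fin n → ℤ,
    h.val *ᵥ x = x + Pi.single α (t * x β) - Pi.single β.swap (t * x α.swap)

lemma exists_root_inl_inl {n : ℕ} {i j : Fin n} (hij : i ≠ j) (t : ℤ) :
    ∃ h ∈ gen n, IsRoot h (Sum.inl i) (Sum.inl j) t := by
  have hm : ∀ s : ℤ, transvection i j s * transvection i j (-s) = 1 := fun s => by
    rw [transvection_mul_transvection_same _ _ hij]; simp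
  let R : GL (Fin n) ℤ := ⟨transvection i j t, transvection i j (-t), hm t, by
    simpa using hm (-t)⟩
  refine ⟨rho R, rho_mem_gen R, fun x => ?_⟩
  have hinv : (R⁻¹).val = transvection i j (-t) := rfl
  have hval : R.val = transvection i j t := rfl
  ext γ
  simp only [rho, hinv, hval, fromBlocks_mulVec]
  rcases γ with p | p
  · simp [transvection, add_mulVec, Pi.single_apply, single_mulVec_eq]
  · simp only [transvection, transpose_add, transpose_single, transpose_one, add_mulVec,
      single_mulVec_eq]
    by_cases hp : p = j <;> simp [hp, sub_eq_add_neg]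

lemma exists_root_inl_inr {n : ℕ} {i j : Fin n} (t : ℤ) :
    ∃ h ∈ gen n, IsRoot h (Sum.inl i) (Sum.inr j) t := by
  refine ⟨nu (Matrix.single i j t - Matrix.single j i t), nu_mem_gen ?_, fun x => ?_⟩
  · simp
  · ext γ
    simp only [nu, fromBlocks_mulVec]
    rcases γ with p | p
    · simp [sub_mulVec, Pi.single_apply, single_mulVec_eq, add_sub_assoc]
    · simp

/-- Conjugating by a coordinate permutation relabels a root; `τ` must commute with the bar because
the root also involves the duals of `α` and `β`. -/
lemma exists_root_of_perm {n : ℕ} {s : GL (Fin n ⊕ Fin n) ℤ} (hs : s ∈ gen n)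
    (τ : Equiv.Perm (Fin n ⊕ Fin n)) (hτ : ∀ γ, τ γ.swap = (τ γ).swap)
    (hsτ : ∀ x : Fin n ⊕ Fin n → ℤ, s.val *ᵥ x = x ∘ τ) {α β : Fin n ⊕ Fin n} {t : ℤ}
    (h : ∃ h ∈ gen n, IsRoot h α β t) : ∃ h ∈ gen n, IsRoot h (τ α) (τ β) t := by
  obtain ⟨h, hh, hr⟩ := h
  refine ⟨s⁻¹ * h * s, mul_mem (mul_mem (inv_mem hs) hh) hs, fun x => ?_⟩
  have key : h.val *ᵥ (s.val *ᵥ x) =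
      s.val *ᵥ (x + Pi.single (τ α) (t * x (τ β)) -
        Pi.single (τ β).swap (t * x (τ α).swap)) := by
    rw [hsτ, hsτ, hr]
    ext γ
    simp [Pi.single_apply, ← hτ]
  rw [Units.val_mul, Units.val_mul, ← mulVec_mulVec, ← mulVec_mulVec, key, mulVec_mulVec,
    ← Units.val_mul, inv_mul_cancel, Units.val_one, one_mulVec]

lemma exists_perm_mem_gen {n : ℕ} (π : Equiv.Perm (Fin n)) :
    ∃ s ∈ gen n, ∀ x : Fin n ⊕ Fin n → ℤ, s.val *ᵥ x = x ∘ (Equiv.sumCongr π π) := by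
  have hm : ∀ π : Equiv.Perm (Fin n), π.permMatrix ℤ * (π⁻¹).permMatrix ℤ = 1 := fun π => by
    rw [← Matrix.permMatrix_mul]; simp
  let R : GL (Fin n) ℤ := ⟨π.permMatrix ℤ, (π⁻¹).permMatrix ℤ, hm π, by simpa using hm π⁻¹⟩
  refine ⟨rho R, rho_mem_gen R, fun x => ?_⟩
  have hinv : (R⁻¹).valᵀ = π.permMatrix ℤ := by
    change ((π⁻¹).permMatrix ℤ)ᵀ = _
    rw [Matrix.transpose_permMatrix, inv_inv]
  have hval : R.val = π.permMatrix ℤ := rfl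
  ext γ
  simp only [rho, hinv, hval, fromBlocks_mulVec, permMatrix_mulVec]
  rcases γ with p | p <;> simp

lemma exists_perm_pair {ι : Type*} [DecidableEq ι] {a b i j : ι} (hab : a ≠ b) (hij : i ≠ j) :
    ∃ π : Equiv.Perm ι, π a = i ∧ π b = j := by
  refine ⟨(Equiv.swap a i).trans (Equiv.swap (Equiv.swap a i b) j), ?_, by simp⟩
  have : Equiv.swap a i b ≠ i := by
    intro h
    exact hab ((Equiv.swap a i).injective ((Equiv.swap_apply_left a i).trans h.symm))
  simp [Equiv.swap_apply_of_ne_of_ne this.symm hij]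

/-- The permutation of the coordinates underlying `σₖ`. -/
def sigmaPerm (n k : ℕ) : Equiv.Perm (Fin n ⊕ Fin n) :=
  Function.Involutive.toPerm (fun γ => if (idx γ).val < k then γ.swap else γ) fun γ => by
    by_cases h : (idx γ).val < k <;> simp [h]

lemma sigmaPerm_apply {n k : ℕ} (γ : Fin n ⊕ Fin n) :
    sigmaPerm n k γ = if (idx γ).val < k then γ.swap else γ := rfl

lemma sigmaPerm_swap {n k : ℕ} (γ : Fin n ⊕ Fin n) :
    sigmaPerm n k γ.swap = (sigmaPerm n k γ).swap := by
  by_cases h : (idx γ).val < k <;> simp [sigmaPerm_apply, h]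

lemma sigma_mulVec_int {n : ℕ} (k : ℕ) (x : Fin n ⊕ Fin n → ℤ) :
    (sigma n k).val *ᵥ x = x ∘ sigmaPerm n k := by
  ext γ
  have := sigma_mulVec k x γ
  have e : (sigma n k).val.map (Int.castRingHom ℤ) = (sigma n k).val := by ext; simp
  rw [e] at this
  rw [this]
  by_cases h : (idx γ).val < k <;> simp [sigmaPerm_apply, h]

/-- Conjugation by `σ₂` turns the root on `(a¹, b₂)` into one on `(b₁, a²)`, and permutation
matrices reach all other pairs. Only here does `σ₂` serve as a generator. -/
lemma exists_root_inr_inl {n : ℕ} (hn : 2 ≤ n) {i j : Fin n} (hij : i ≠ j) (t : ℤ) :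
    ∃ h ∈ gen n, IsRoot h (Sum.inr i) (Sum.inl j) t := by
  let z : Fin n := ⟨0, by omega⟩
  let o : Fin n := ⟨1, by omega⟩
  have hzo : z ≠ o := by simp [z, o]
  have h1 := exists_root_of_perm (sigma_mem_gen n) (sigmaPerm n 2) sigmaPerm_swap
    (sigma_mulVec_int 2) (exists_root_inl_inr (i := z) (j := o) t)
  have e1 : sigmaPerm n 2 (Sum.inl z) = Sum.inr z := by simp [sigmaPerm_apply, z]
  have e2 : sigmaPerm n 2 (Sum.inr o) = Sum.inl o := by simp [sigmaPerm_apply, o]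
  rw [e1, e2] at h1
  obtain ⟨π, hz, ho⟩ := exists_perm_pair hzo hij
  obtain ⟨s, hs, hsx⟩ := exists_perm_mem_gen π
  have h2 := exists_root_of_perm hs _ (fun γ => by cases γ <;> simp) hsx h1
  simpa [hz, ho] using h2

lemma exists_root {n : ℕ} (hn : 2 ≤ n) {α β : Fin n ⊕ Fin n} (h : idx α ≠ idx β) (t : ℤ) :
    ∃ h ∈ gen n, IsRoot h α β t := by
  rcases α with i | i <;> rcases β with j | j
  · exact exists_root_inl_inl h t
  · exact exists_root_inl_inr t
  · exact exists_root_inr_inl hn h t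
  -- The roots `(α, β, t)` and `(β̄, ᾱ, -t)` are the same transformation.
  · obtain ⟨g, hg, hr⟩ := exists_root_inl_inl (i := j) (j := i) (Ne.symm h) (-t)
    refine ⟨g, hg, fun x => ?_⟩
    rw [hr x]
    simp only [neg_mul, Pi.single_neg, Sum.swap_inl, Sum.swap_inr]
    abel

/-! ### Integral isometries -/

lemma quadForm_mulVec {n : ℕ} {g : GL (Fin n ⊕ Fin n) ℤ} (hg : g ∈ SOInt n)
    (x : Fin n ⊕ Fin n → ℤ) : quadForm n ℤ (g.val *ᵥ x) = quadForm n ℤ x := by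
  have hcast : ∀ y : Fin n ⊕ Fin n → ℤ,
      quadForm n ℝ (fun i => (y i : ℝ)) = (quadForm n ℤ y : ℝ) := fun y => by
    simp [quadForm]
  have h : quadForm n ℝ ((g.val.map (Int.castRingHom ℝ)) *ᵥ fun i => (x i : ℝ)) = _ :=
    hg.1 fun i => (x i : ℝ)
  have e : (g.val.map (Int.castRingHom ℝ)) *ᵥ (fun i => (x i : ℝ)) =
      fun i => ((g.val *ᵥ x) i : ℝ) := by
    ext i
    exact (RingHom.map_mulVec (Int.castRingHom ℝ) g.val x i).symm
  rw [e, hcast, hcast] at h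
  exact_mod_cast h

/-- The increment is the pairing of `x` with the isotropic vector `e_γ`, so coordinates can be read
off the quadratic form alone. -/
lemma quadForm_add_single {n : ℕ} (x : Fin n ⊕ Fin n → ℤ) (γ : Fin n ⊕ Fin n) :
    quadForm n ℤ (x + Pi.single γ 1) = quadForm n ℤ x + x γ.swap := by
  rcases γ with k | k <;>
    simp [quadForm, Pi.single_apply, add_mul, mul_add, Finset.sum_add_distrib]

lemma quadForm_eq_mul {n : ℕ} {x : Fin n ⊕ Fin n → ℤ} {α : Fin n ⊕ Fin n}
    (hx : ∀ β, idx β ≠ idx α → x β = 0) : quadForm n ℤ x = x α * x α.swap := by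
  rw [quadForm, Finset.sum_eq_single (idx α)]
  · rcases α with k | k <;> simp [mul_comm]
  · intro i _ hi
    rw [hx (Sum.inl i) hi, zero_mul]
  · simp

lemma quadForm_single {n : ℕ} (γ : Fin n ⊕ Fin n) :
    quadForm n ℤ (Pi.single γ 1) = 0 := by
  have h := quadForm_add_single 0 γ
  simpa [quadForm] using h

/-- The dual coordinate is the pairing with `e_γ`, which `g` fixes. -/
lemma mulVec_apply_swap {n : ℕ} {g : GL (Fin n ⊕ Fin n) ℤ} (hg : g ∈ SOInt n)
    {γ : Fin n ⊕ Fin n} (hγ : g.val *ᵥ Pi.single γ 1 = Pi.single γ 1)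
    (x : Fin n ⊕ Fin n → ℤ) : (g.val *ᵥ x) γ.swap = x γ.swap := by
  have h := quadForm_mulVec hg (x + Pi.single γ 1)
  rw [mulVec_add, hγ, quadForm_add_single, quadForm_add_single, quadForm_mulVec hg] at h
  linarith

/-- The image is isotropic and lies in one hyperbolic plane, so the product of its two coordinates
there vanishes. -/
lemma mulVec_single_eq_single {n : ℕ} {g : GL (Fin n ⊕ Fin n) ℤ} (hg : g ∈ SOInt n)
    {α γ : Fin n ⊕ Fin n} {d : ℤ} (hd : (g.val *ᵥ Pi.single γ 1) α = d) (hd0 : d ≠ 0)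
    (h : ∀ β, idx β ≠ idx α → (g.val *ᵥ Pi.single γ 1) β = 0) :
    g.val *ᵥ Pi.single γ 1 = Pi.single α d := by
  have hq := quadForm_mulVec hg (Pi.single γ 1)
  rw [quadForm_single, quadForm_eq_mul h, hd] at hq
  have h0 := (mul_eq_zero.mp hq).resolve_left hd0
  ext β
  by_cases hβ : idx β = idx α
  · rcases eq_or_eq_swap hβ with rfl | rfl
    · simp [hd]
    · simp [h0, swap_ne_self]
  · rw [h β hβ, Pi.single_eq_of_ne (ne_of_idx_ne hβ)]

/-! ### Euclidean reduction inside the stabilizers -/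

/-- The transformations fixing all coordinate vectors whose index lies in `S`. -/
def fixing {n : ℕ} (S : Finset (Fin n)) : Subgroup (GL (Fin n ⊕ Fin n) ℤ) where
  carrier := {g | ∀ γ, idx γ ∈ S → g.val *ᵥ Pi.single γ 1 = Pi.single γ 1}
  one_mem' := fun γ _ => by rw [Units.val_one, one_mulVec]
  mul_mem' := by
    intro g h hg hh γ hγ
    rw [Units.val_mul, ← mulVec_mulVec, hh γ hγ, hg γ hγ]
  inv_mem' := by
    intro g hg γ hγ
    nth_rewrite 1 [← hg γ hγ]
    rw [mulVec_mulVec, ← Units.val_mul, inv_mul_cancel, Units.val_one, one_mulVec]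

lemma mul_mulVec {n : ℕ} (g h : GL (Fin n ⊕ Fin n) ℤ) (x : Fin n ⊕ Fin n → ℤ) :
    (g * h).val *ᵥ x = g.val *ᵥ (h.val *ᵥ x) := by
  rw [Units.val_mul, mulVec_mulVec]

lemma mulVec_single_apply_eq_zero {n : ℕ} {S : Finset (Fin n)} {g : GL (Fin n ⊕ Fin n) ℤ}
    (hg : g ∈ SOInt n) (hS : g ∈ fixing S) {α β : Fin n ⊕ Fin n} (hα : idx α ∉ S)
    (hβ : idx β ∈ S) : (g.val *ᵥ Pi.single α 1) β = 0 := by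
  have h := mulVec_apply_swap hg (hS β.swap (by simpa using hβ)) (Pi.single α 1)
  rw [Sum.swap_swap] at h
  rw [h, Pi.single_eq_of_ne]
  rintro rfl
  exact hα hβ

lemma IsRoot.mem_fixing {n : ℕ} {S : Finset (Fin n)} {h : GL (Fin n ⊕ Fin n) ℤ}
    {α β : Fin n ⊕ Fin n} {t : ℤ} (hr : IsRoot h α β t) (hα : idx α ∉ S) (hβ : idx β ∉ S) :
    h ∈ fixing S := by
  intro γ hγ
  have h1 : β ≠ γ := by rintro rfl; exact hβ hγ
  have h2 : α.swap ≠ γ := by rintro rfl; exact hα (by simpa using hγ)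
  rw [hr]
  simp [Pi.single_eq_of_ne h1, Pi.single_eq_of_ne h2]

lemma exists_root_fixing {n : ℕ} (hn : 2 ≤ n) (S : Finset (Fin n)) {α β : Fin n ⊕ Fin n}
    (hα : idx α ∉ S) (hβ : idx β ∉ S) (h : idx α ≠ idx β) (t : ℤ) :
    ∃ h ∈ gen n ⊓ fixing S, IsRoot h α β t := by
  obtain ⟨h, hh, hr⟩ := exists_root hn h t
  exact ⟨h, ⟨hh, hr.mem_fixing hα hβ⟩, hr⟩

/-- If `v α` divides the coordinates in `F`, they can be cleared without changing the others,
except for the one dual to `α`. -/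
lemma exists_clear {n : ℕ} (hn : 2 ≤ n) {S : Finset (Fin n)} {α : Fin n ⊕ Fin n}
    (hα : idx α ∉ S) (v : Fin n ⊕ Fin n → ℤ) (F : Finset (Fin n ⊕ Fin n))
    (hF : ∀ β ∈ F, idx β ∉ S ∧ idx β ≠ idx α ∧ v α ∣ v β) :
    ∃ h ∈ gen n ⊓ fixing S, h.val *ᵥ Pi.single α.swap 1 = Pi.single α.swap 1 ∧
      ∀ β, β ≠ α.swap → (h.val *ᵥ v) β = if β ∈ F then 0 else v β := by
  induction F using Finset.induction_on with
  | empty => exact ⟨1, one_mem _, by rw [Units.val_one, one_mulVec], by simp⟩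
  | insert β F hβF ih =>
    obtain ⟨h, hh, hfix, hv⟩ := ih fun γ hγ => hF γ (Finset.mem_insert_of_mem hγ)
    obtain ⟨hβS, hβα, t, ht⟩ := hF β (Finset.mem_insert_self _ _)
    have hβα' : β ≠ α.swap := ne_of_idx_ne (by simpa using hβα)
    have hαF : α ∉ F := fun hm => (hF α (Finset.mem_insert_of_mem hm)).2.1 rfl
    obtain ⟨r, hr, hroot⟩ := exists_root_fixing hn S hβS hα hβα (-t)
    refine ⟨r * h, mul_mem hr hh, ?_, fun γ hγ => ?_⟩
    · have h1 : α ≠ α.swap := (swap_ne_self α).symm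
      have h2 : β.swap ≠ α.swap := ne_of_idx_ne (by simpa using hβα)
      rw [mul_mulVec, hfix, hroot]
      simp [Pi.single_eq_of_ne h1, Pi.single_eq_of_ne h2]
    · rw [mul_mulVec, hroot]
      simp only [Pi.sub_apply, Pi.add_apply, Pi.single_eq_of_ne hγ, sub_zero]
      rw [hv γ hγ, hv α (swap_ne_self α).symm, if_neg hαF]
      by_cases hγβ : γ = β
      · subst hγβ
        simp only [hβF, if_false, Pi.single_eq_same, Finset.mem_insert_self, if_true, ht]
        ring
      · simp [hγβ]

/-- Fixing the vector dual to `α` allows the second vector of a plane to be straightened without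
disturbing the first. -/
lemma exists_clear_all {n : ℕ} (hn : 2 ≤ n) {S : Finset (Fin n)} {α : Fin n ⊕ Fin n}
    (hα : idx α ∉ S) (v : Fin n ⊕ Fin n → ℤ) (hS : ∀ β, idx β ∈ S → v β = 0)
    (hdvd : ∀ β, idx β ∉ S → idx β ≠ idx α → v α ∣ v β) :
    ∃ h ∈ gen n ⊓ fixing S, h.val *ᵥ Pi.single α.swap 1 = Pi.single α.swap 1 ∧
      (h.val *ᵥ v) α = v α ∧ ∀ β, idx β ≠ idx α → (h.val *ᵥ v) β = 0 := by
  obtain ⟨h, hh, hfix, hv⟩ := exists_clear hn hα v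
    (Finset.univ.filter fun β => idx β ∉ S ∧ idx β ≠ idx α)
    (fun β hβ => by
      have h2 := (Finset.mem_filter.mp hβ).2
      exact ⟨h2.1, h2.2, hdvd β h2.1 h2.2⟩)
  refine ⟨h, hh, hfix, ?_, fun β hβ => ?_⟩
  · rw [hv α (swap_ne_self α).symm]; simp
  · rw [hv β (ne_of_idx_ne (by simpa using hβ))]
    by_cases hS' : idx β ∈ S
    · simp [hS', hS β hS']
    · simp [hS', hβ]

/-- A signed coordinate vector can be moved to any coordinate vector of another index. -/
lemma exists_move {n : ℕ} (hn : 2 ≤ n) {S : Finset (Fin n)} {α β : Fin n ⊕ Fin n}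
    (hα : idx α ∉ S) (hβ : idx β ∉ S) (hαβ : idx β ≠ idx α) {d : ℤ} (hd : d * d = 1) :
    ∃ h ∈ gen n ⊓ fixing S, h.val *ᵥ Pi.single α d = Pi.single β 1 := by
  -- Since `d * d = 1`, `r` sends `d e_α` to `d e_α + e_β`, and `s` then removes `d e_α`.
  obtain ⟨r, hr, hroot⟩ := exists_root_fixing hn S hβ hα hαβ d
  obtain ⟨s, hs, hsroot⟩ := exists_root_fixing hn S hα hβ hαβ.symm (-d)
  refine ⟨s * r, mul_mem hs hr, ?_⟩
  have h1 : β.swap ≠ α := ne_of_idx_ne (by simpa using hαβ)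
  have h2 : α.swap ≠ β := ne_of_idx_ne (by simpa using hαβ.symm)
  have h3 : β ≠ α := ne_of_idx_ne hαβ
  rw [mul_mulVec, hroot, hsroot]
  ext γ
  simp [Pi.single_eq_of_ne h1, Pi.single_eq_of_ne h2, Pi.single_eq_of_ne h3, hd,
    Pi.single_eq_of_ne (swap_ne_self α), Pi.single_neg]

/-- An isometry fixing the coordinate vectors over `S` can be modified by the generated subgroup
so that a given coordinate vector goes to a signed coordinate vector. -/
lemma exists_mulVec_single {n : ℕ} (hn : 2 ≤ n) {S : Finset (Fin n)}
    {g : GL (Fin n ⊕ Fin n) ℤ} (hg : g ∈ SOInt n) (hS : g ∈ fixing S) {γ : Fin n ⊕ Fin n}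
    (hγ : idx γ ∉ S) :
    ∃ h ∈ gen n ⊓ fixing S, ∃ α, idx α ∉ S ∧ ∃ d : ℤ, d * d = 1 ∧
      (h * g).val *ᵥ Pi.single γ 1 = Pi.single α d := by
  classical
  let P : ℕ → Prop := fun m => m ≠ 0 ∧ ∃ h ∈ gen n ⊓ fixing S, ∃ α,
    (((h * g).val *ᵥ Pi.single γ 1) α).natAbs = m
  have hne : ∀ u : GL (Fin n ⊕ Fin n) ℤ, u⁻¹.val *ᵥ (u.val *ᵥ Pi.single γ 1) =
      (Pi.single γ 1 : Fin n ⊕ Fin n → ℤ) := fun u => by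
    rw [← mul_mulVec, inv_mul_cancel, Units.val_one, one_mulVec]
  have hex : ∃ m, P m := by
    by_contra hno
    have hz : g.val *ᵥ Pi.single γ 1 = 0 := by
      ext α
      by_contra hα
      exact hno ⟨_, Int.natAbs_ne_zero.mpr hα, 1, one_mem _, α, by rw [one_mul]⟩
    have := hne g
    rw [hz, mulVec_zero] at this
    simpa using congrFun this γ
  obtain ⟨hm0, h, hh, α, hα⟩ := Nat.find_spec hex
  have hmin : ∀ h' ∈ gen n ⊓ fixing S, ∀ β,
      (((h' * g).val *ᵥ Pi.single γ 1) β).natAbs < Nat.find hex →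
      ((h' * g).val *ᵥ Pi.single γ 1) β = 0 := by
    intro h' hh' β hlt
    by_contra h0
    exact Nat.find_min hex hlt ⟨Int.natAbs_ne_zero.mpr h0, h', hh', β, rfl⟩
  have hmem : ∀ h' ∈ gen n ⊓ fixing S, h' * g ∈ SOInt n ∧ h' * g ∈ fixing S := fun h' hh' =>
    ⟨mul_mem (gen_le_SOInt hn hh'.1) hg, mul_mem hh'.2 hS⟩
  have hv0 : ∀ h' ∈ gen n ⊓ fixing S, ∀ β, idx β ∈ S →
      ((h' * g).val *ᵥ Pi.single γ 1) β = 0 := fun h' hh' β hβ =>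
    mulVec_single_apply_eq_zero (hmem h' hh').1 (hmem h' hh').2 hγ hβ
  generalize hvdef : (h * g).val *ᵥ Pi.single γ 1 = v at hα
  have hvα : v α ≠ 0 := by
    intro h0; rw [h0] at hα; exact hm0 hα.symm
  have hαS : idx α ∉ S := fun hmem => hvα (hvdef ▸ hv0 h hh α hmem)
  have hdvd : ∀ β, idx β ∉ S → idx β ≠ idx α → v α ∣ v β := by
    intro β hβS hβα
    -- This root replaces `v β` by its remainder modulo `v α`, which is below the minimum and hence
    -- zero.
    obtain ⟨r, hr, hroot⟩ := exists_root_fixing hn S hβS hαS hβα (-(v β / v α))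
    have hβα' : β ≠ α.swap := ne_of_idx_ne (by simpa using hβα)
    have hval : ((r * h * g).val *ᵥ Pi.single γ 1) β = v β % v α := by
      rw [mul_assoc, mul_mulVec, hvdef, hroot]
      simp only [Pi.sub_apply, Pi.add_apply, Pi.single_eq_same, Pi.single_eq_of_ne hβα']
      rw [Int.emod_def]; ring
    have := hmin (r * h) (mul_mem hr hh) β (by
      rw [hval, ← hα]
      have h1 := Int.emod_nonneg (v β) hvα
      have h2 := Int.emod_lt_abs (v β) hvα
      rw [Int.abs_eq_natAbs] at h2
      omega)
    rw [hval] at this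
    exact Int.dvd_of_emod_eq_zero this
  obtain ⟨c, hc, -, hcα, hcz⟩ := exists_clear_all hn hαS v
    (fun β hβ => hvdef ▸ hv0 h hh β hβ) hdvd
  have hch := mul_mem hc hh
  have hcv : (c * h * g).val *ᵥ Pi.single γ 1 = c.val *ᵥ v := by
    rw [mul_assoc, mul_mulVec, hvdef]
  have hs := mulVec_single_eq_single (hmem _ hch).1 (α := α) (γ := γ) (d := v α)
    (by rw [hcv, hcα]) hvα (by rw [hcv]; exact hcz)
  refine ⟨c * h, hch, α, hαS, v α, ?_, hs⟩
  -- Applying the inverse matrix to `v α • e_α` gives `e_γ`, so `v α` divides `1`.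
  have h1 := congrFun (hne (c * h * g)) γ
  rw [hs, Pi.single_eq_same, mulVec_single] at h1
  have h2 : (c * h * g)⁻¹.val γ α * v α = 1 := h1
  have hu : IsUnit (v α) := IsUnit.of_mul_eq_one ((c * h * g)⁻¹.val γ α) (by rwa [mul_comm])
  exact Int.isUnit_mul_self hu

lemma exists_mulVec_single_eq {n : ℕ} (hn : 2 ≤ n) {S : Finset (Fin n)}
    {g : GL (Fin n ⊕ Fin n) ℤ} (hg : g ∈ SOInt n) (hS : g ∈ fixing S) {γ : Fin n ⊕ Fin n}
    (hγ : idx γ ∉ S) {j : Fin n} (hj : j ∉ S) (hjγ : j ≠ idx γ) :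
    ∃ h ∈ gen n ⊓ fixing S, (h * g).val *ᵥ Pi.single γ 1 = Pi.single γ 1 := by
  obtain ⟨h, hh, α, hα, d, hd, hv⟩ := exists_mulVec_single hn hg hS hγ
  by_cases hαγ : idx γ = idx α
  -- Moves need distinct indices, so a vector already in the plane of `γ` makes a detour through
  -- `a^j`.
  · obtain ⟨r, hr, hrv⟩ := exists_move hn (β := Sum.inl j) hα hj (by simpa [← hαγ]) hd
    obtain ⟨s, hs, hsv⟩ := exists_move hn (α := Sum.inl j) (β := γ) (d := 1) hj hγ
      (by simpa using hjγ.symm) rfl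
    refine ⟨s * r * h, mul_mem (mul_mem hs hr) hh, ?_⟩
    rw [mul_assoc, mul_assoc, mul_mulVec, mul_mulVec, hv, hrv, hsv]
  · obtain ⟨r, hr, hrv⟩ := exists_move hn hα hγ hαγ hd
    refine ⟨r * h, mul_mem hr hh, ?_⟩
    rw [mul_assoc, mul_mulVec, hv, hrv]

lemma exists_mul_mem_fixing_insert {n : ℕ} (hn : 2 ≤ n) {S : Finset (Fin n)}
    {g : GL (Fin n ⊕ Fin n) ℤ} (hg : g ∈ SOInt n) (hS : g ∈ fixing S) {k j : Fin n}
    (hk : k ∉ S) (hj : j ∉ S) (hjk : j ≠ k) :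
    ∃ h ∈ gen n, h * g ∈ fixing (insert k S) := by
  obtain ⟨h, hh, hv⟩ := exists_mulVec_single_eq hn hg hS (γ := Sum.inl k) hk hj hjk
  have hhg : h * g ∈ SOInt n := mul_mem (gen_le_SOInt hn hh.1) hg
  have hhS : h * g ∈ fixing S := mul_mem hh.2 hS
  have hone : ((h * g).val *ᵥ Pi.single (Sum.inr k) 1) (Sum.inr k) = 1 := by
    simpa using mulVec_apply_swap hhg hv (Pi.single (Sum.inr k) 1)
  obtain ⟨c, hc, hfix, hcα, hcz⟩ := exists_clear_all hn (α := Sum.inr k) (S := S) hk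
    ((h * g).val *ᵥ Pi.single (Sum.inr k) 1)
    (fun β hβ => mulVec_single_apply_eq_zero hhg hhS hk hβ)
    (fun β _ _ => by rw [hone]; exact one_dvd _)
  have hw := mulVec_single_eq_single (g := c * (h * g))
    (mul_mem (gen_le_SOInt hn hc.1) hhg) (α := Sum.inr k) (γ := Sum.inr k) (d := 1)
    (by rw [mul_mulVec, hcα, hone]) one_ne_zero (by rw [mul_mulVec]; exact hcz)
  refine ⟨c * h, mul_mem hc.1 hh.1, fun γ hγ => ?_⟩
  rw [mul_assoc]
  rcases Finset.mem_insert.mp hγ with hγ | hγ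
  · rcases γ with i | i <;> obtain rfl : i = k := hγ
    · rw [mul_mulVec, hv]; exact hfix
    · exact hw
  · exact (mul_mem hc.2 hhS) γ hγ

/-! ### The last hyperbolic plane -/

lemma ext_mulVec_single {n : ℕ} {A B : Matrix (Fin n ⊕ Fin n) (Fin n ⊕ Fin n) ℤ}
    (h : ∀ γ, A *ᵥ Pi.single γ 1 = B *ᵥ Pi.single γ 1) : A = B := by
  ext i γ
  simpa using congrFun (h γ) i

lemma exists_rho_scaling {n : ℕ} (k : Fin n) {d : ℤ} (hd : d * d = 1) :
    ∃ R : GL (Fin n) ℤ, ∀ γ, (rho R).val *ᵥ Pi.single γ 1 =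
      Pi.single γ (if idx γ = k then d else 1) := by
  have hm : (diagonal fun i => if i = k then d else 1 : Matrix (Fin n) (Fin n) ℤ) *
      (diagonal fun i => if i = k then d else 1) = 1 := by
    rw [diagonal_mul_diagonal, ← diagonal_one]
    congr 1
    ext i
    by_cases hi : i = k <;> simp [hi, hd]
  let R : GL (Fin n) ℤ := ⟨_, _, hm, hm⟩
  refine ⟨R, fun γ => ?_⟩
  have hval : R.val = diagonal fun i => if i = k then d else 1 := rfl
  have hinv : R⁻¹.val = diagonal fun i => if i = k then d else 1 := rfl
  ext δ
  rcases γ with i | i <;> rcases δ with j | j <;>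
    simp [rho, hval, hinv, Pi.single_apply]
  all_goals
    by_cases hij : j = i
    · subst hij; simp only [if_true]; rfl
    · simp [hij]

lemma mem_gen_of_fixing_compl_singleton {n : ℕ} {k : Fin n} {g : GL (Fin n ⊕ Fin n) ℤ}
    (hg : g ∈ SOInt n) (hS : g ∈ fixing {k}ᶜ) : g ∈ gen n := by
  have hfix : ∀ γ, idx γ ≠ k → g.val *ᵥ Pi.single γ 1 = Pi.single γ 1 := fun γ hγ =>
    hS γ (by simpa using hγ)
  have hz : ∀ γ, idx γ = k → ∀ β, idx β ≠ k → (g.val *ᵥ Pi.single γ 1) β = 0 :=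
    fun γ hγ β hβ => mulVec_single_apply_eq_zero hg hS (by simpa using hγ) (by simpa using hβ)
  have hq : ∀ γ, idx γ = k → (g.val *ᵥ Pi.single γ 1) (Sum.inl k) *
      (g.val *ᵥ Pi.single γ 1) (Sum.inr k) = 0 := fun γ hγ => by
    rw [← quadForm_single γ, ← quadForm_mulVec hg, quadForm_eq_mul (α := Sum.inl k) (hz γ hγ)]
    rfl
  have hexp : ∀ γ, idx γ = k → g.val *ᵥ Pi.single γ 1 =
      Pi.single (Sum.inl k) ((g.val *ᵥ Pi.single γ 1) (Sum.inl k)) +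
      Pi.single (Sum.inr k) ((g.val *ᵥ Pi.single γ 1) (Sum.inr k)) := fun γ hγ => by
    ext β
    by_cases hβ : idx β = k
    · rcases β with i | i <;> obtain rfl : i = k := hβ <;> simp
    · have h1 : β ≠ Sum.inl k := ne_of_idx_ne hβ
      have h2 : β ≠ Sum.inr k := ne_of_idx_ne hβ
      rw [hz γ hγ β hβ]
      simp [h1, h2]
  -- With `p, q` and `r, s` the coordinates of the two images, this gives `(p + r)(q + s) = 1`,
  -- while isotropy gives `pq = rs = 0`.
  have hpair := quadForm_mulVec hg (Pi.single (Sum.inl k) 1 + Pi.single (Sum.inr k) 1)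
  rw [quadForm_add_single, quadForm_single, mulVec_add, quadForm_eq_mul (α := Sum.inl k)
    (fun β hβ => by rw [Pi.add_apply, hz _ rfl β hβ, hz _ rfl β hβ, add_zero])] at hpair
  have ql := hq (Sum.inl k) rfl
  have qr := hq (Sum.inr k) rfl
  have el := hexp (Sum.inl k) rfl
  have er := hexp (Sum.inr k) rfl
  simp only [Pi.add_apply, Sum.swap_inl, Sum.swap_inr, Pi.single_eq_same, zero_add] at hpair
  generalize (g.val *ᵥ Pi.single (Sum.inl k) 1) (Sum.inl k) = p at *
  generalize (g.val *ᵥ Pi.single (Sum.inl k) 1) (Sum.inr k) = q at *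
  generalize (g.val *ᵥ Pi.single (Sum.inr k) 1) (Sum.inl k) = r at *
  generalize (g.val *ᵥ Pi.single (Sum.inr k) 1) (Sum.inr k) = s at *
  have hdet : p * s + r * q = 1 := by linear_combination hpair - ql - qr
  rcases mul_eq_zero.mp ql with hp | hq0
  · exfalso
    rw [hp, zero_mul, zero_add] at hdet
    have hr0 : r ≠ 0 := by rintro rfl; simp at hdet
    have hs0 := (mul_eq_zero.mp qr).resolve_left hr0
    have hrq : r = q := Int.eq_of_mul_eq_one hdet
    subst hrq
    obtain ⟨R, hR⟩ := exists_rho_scaling k hdet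
    -- In the antidiagonal case, `g` times a transposition would be some `ρ(R)`, forcing `det g =
    -- -1`.
    have e : g.val * (Equiv.swap (Sum.inl k : Fin n ⊕ Fin n) (Sum.inr k)).permMatrix ℤ =
        (rho R).val := by
      refine ext_mulVec_single fun γ => ?_
      have hsw : (Equiv.swap (Sum.inl k : Fin n ⊕ Fin n) (Sum.inr k)).permMatrix ℤ *ᵥ
          Pi.single γ 1 = Pi.single (Equiv.swap (Sum.inl k) (Sum.inr k) γ) 1 := by
        rw [permMatrix_mulVec]
        ext δ
        simp [Pi.single_apply, Equiv.swap_apply_eq_iff]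
      rw [← mulVec_mulVec, hsw, hR]
      by_cases hγ : idx γ = k
      · rcases γ with i | i <;> obtain rfl : i = k := hγ
        · rw [Equiv.swap_apply_left, er, hs0]; simp
        · rw [Equiv.swap_apply_right, el, hp]; simp
      · rw [Equiv.swap_apply_of_ne_of_ne (ne_of_idx_ne hγ) (ne_of_idx_ne hγ), hfix γ hγ,
          if_neg hγ]
    have h1 : g.val.det = 1 := congrArg Units.val hg.2
    have h2 : (rho R).val.det = 1 := congrArg Units.val (rho_mem_SOInt R).2
    have h3 := congrArg det e
    rw [det_mul, h1, h2, det_permutation, Equiv.Perm.sign_swap (by simp)] at h3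
    norm_num at h3
  · subst hq0
    rw [mul_zero, add_zero] at hdet
    have hs0 : s ≠ 0 := by rintro rfl; simp at hdet
    have hr0 := (mul_eq_zero.mp qr).resolve_right hs0
    have hps : p = s := Int.eq_of_mul_eq_one hdet
    subst hps
    obtain ⟨R, hR⟩ := exists_rho_scaling k hdet
    have e : g = rho R := by
      refine Units.ext (ext_mulVec_single fun γ => ?_)
      rw [hR]
      by_cases hγ : idx γ = k
      · rcases γ with i | i <;> obtain rfl : i = k := hγ
        · rw [el]; simp
        · rw [er, hr0]; simp
      · rw [hfix γ hγ, if_neg hγ]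
    rw [e]
    exact rho_mem_gen R

lemma mem_gen_of_mem_fixing {n : ℕ} (hn : 2 ≤ n) (m : ℕ) :
    ∀ (S : Finset (Fin n)), Sᶜ.card = m → ∀ g ∈ SOInt n, g ∈ fixing S → g ∈ gen n := by
  induction m with
  | zero =>
    intro S hSm g _ hS
    have h1 : g = 1 := by
      refine Units.ext (ext_mulVec_single fun γ => ?_)
      rw [hS γ (by simpa using Finset.ext_iff.mp (Finset.card_eq_zero.mp hSm) (idx γ)),
        Units.val_one, one_mulVec]
    rw [h1]
    exact one_mem _
  | succ m ih =>
    intro S hSm g hg hS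
    rcases Nat.eq_zero_or_pos m with rfl | hm
    · obtain ⟨k, hk⟩ := Finset.card_eq_one.mp hSm
      rw [← compl_compl S, hk] at hS
      exact mem_gen_of_fixing_compl_singleton hg hS
    · obtain ⟨k, hk, j, hj, hkj⟩ := Finset.one_lt_card.mp (by omega : 1 < Sᶜ.card)
      obtain ⟨h, hh, hfix⟩ := exists_mul_mem_fixing_insert hn hg hS
        (Finset.mem_compl.mp hk) (Finset.mem_compl.mp hj) hkj.symm
      have hcard : (insert k S)ᶜ.card = m := by
        rw [Finset.compl_insert, Finset.card_erase_of_mem hk, hSm, Nat.add_sub_cancel]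
      have := ih _ hcard (h * g) (mul_mem (gen_le_SOInt hn hh) hg) hfix
      exact (Subgroup.mul_mem_cancel_left _ hh).mp this

end SplitOrthogonal

theorem mainTheorem3 (n : ℕ) (hn : 2 ≤ n) :
    Subgroup.closure
      (Set.range (SplitOrthogonal.rho (n := n)) ∪
        SplitOrthogonal.nu '' {N : Matrix (Fin n) (Fin n) ℤ | N.transpose = -N} ∪
        {SplitOrthogonal.sigma n 2}) = SplitOrthogonal.SOInt n :=
  le_antisymm (SplitOrthogonal.gen_le_SOInt hn) fun g hg =>
    SplitOrthogonal.mem_gen_of_mem_fixing hn _ ∅ rfl g hg fun γ hγ => by simp at hγ
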